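/- Let $W_e$ denote the domain of the $e$-th partial computable function, so that $(W_e)_{e\in\omega}$ is the standard uniform enumeration of all c.e. subsets of $\omega$; let $\mathbf{CE}$ be the collection of all c.e. subsets of $\omega$, and let $i =^{ce} j$ mean $W_i=W_j$. For equivalence relations $E,F$ on $\omega$, a (computable) reduction of $E$ to $F$ is a computable $f:\omega\to\omega$ such that $x\,E\,y \Leftrightarrow f(x)\,F\,f(y)$ for all $x,y$; we write $E\le_c F$ if one exists. Two sets $A,B\subseteq\omega$ are computably isomorphic if $h(A)=B$ for some computable permutation $h$ of $\omega$. A computable group is a group whose elements are coded injectively by the members of a computable subset of $\omega$ so that multiplication is computable on codes. A computable subgroup $G$ of $S_\infty$ is the group of permutations of $\omega$ induced by a (not necessarily faithful) computable action of a computable group on $\omega$, and $i\mathrel{R^{ce}_G}j$ means $W_i=\gamma(W_j)$ for some $\gamma\in G$. A c.e. orbit equivalence relation is a relation $E$ on $\omega$ of the form $i\,E\,j\Leftrightarrow(\exists\gamma\in\Gamma)(\gamma\cdot W_i=W_j)$, where $\Gamma$ is a computable group acting on $\mathbf{CE}$ computably in indices, i.e. there is a computable function $\alpha$ with $W_{\alpha(\gamma,e)}=\gamma\cdot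 W_e$ for all $\gamma\in\Gamma$, $e\in\omega$. Theorem. There is a reduction $f$ of $=^{ce}$ to itself such that, for all $i,j$, if $W_i\neq W_j$, then $W_{f(i)}$ and $W_{f(j)}$ are not computably isomorphic. In particular, this same $f$ is a reduction of $=^{ce}$ to $R^{ce}_G$ for every computable subgroup $G$ of $S_\infty$. Moreover, $=^{ce}$ is the least c.e. orbit equivalence relation with respect to $\le_c$: it is itself a c.e. orbit equivalence relation, and $=^{ce}\ \le_c E$ for every c.e. orbit equivalence relation $E$. -/

import Mathlib

namespace CeOrbit

/-- The `e`-th computably enumerable set: the domain of the `e`-th partial recursive function. -/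
def W (e : ℕ) : Set ℕ :=
  {n | ((Denumerable.ofNat Nat.Partrec.Code e).eval n).Dom}

/-- Every `W e` is computably enumerable. -/
theorem re_W (e : ℕ) : REPred (fun n => n ∈ W e) :=
  Partrec.dom_re (Nat.Partrec.Code.eval_part.comp (Computable.const _) Computable.id)

/-- The collection of computably enumerable subsets of `ℕ`. -/
abbrev CE : Type := {A : Set ℕ // REPred (fun n => n ∈ A)}

/-- `W e` as an element of the collection of computably enumerable sets. -/
def Wce (e : ℕ) : CE := ⟨W e, re_W e⟩

/-- The relation `=^{ce}` on indices. -/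
def EqCe (i j : ℕ) : Prop := W i = W j

/-- `f` is a computable reduction of the relation `E` to the relation `F`. -/
def IsReduction (f : ℕ → ℕ) (E F : ℕ → ℕ → Prop) : Prop :=
  Computable f ∧ ∀ x y, E x y ↔ F (f x) (f y)

/-- `E ≤_c F`: computable reducibility. -/
def Reducible (E F : ℕ → ℕ → Prop) : Prop := ∃ f : ℕ → ℕ, IsReduction f E F

/-- Two sets are computably isomorphic if a computable permutation of `ℕ` maps one onto
the other. -/
def CompIso (A B : Set ℕ) : Prop := ∃ h : ℕ ≃ ℕ, h.Computable ∧ h '' A = B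

/-- A computable group: its elements are coded injectively by the members of a computable set of
natural numbers, and multiplication is computable on codes (inversion is then computable too). -/
structure ComputableGroup (Γ : Type) [Group Γ] where
  code : Γ → ℕ
  code_injective : Function.Injective code
  range_computable : ComputablePred (fun n => n ∈ Set.range code)
  mul_computable : ∃ m : ℕ → ℕ → ℕ, Computable₂ m ∧
    ∀ g h : Γ, m (code g) (code h) = code (g * h)

/-- A computable subgroup of `S_∞` (a computable permutation group on `ℕ`): the group of
permutations induced by a computable group acting computably by permutations on `ℕ`. The action
need not be faithful. -/
def IsComputablePermGroup (G : Subgroup (Equiv.Perm ℕ)) : Prop :=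
  ∃ (Γ : Type) (_ : Group Γ) (c : ComputableGroup Γ) (ρ : Γ →* Equiv.Perm ℕ),
    (∃ a : ℕ → ℕ → ℕ, Computable₂ a ∧ ∀ (g : Γ) (n : ℕ), a (c.code g) n = ρ g n) ∧
    G = ρ.range

/-- The relation `R^{ce}_G` on indices. -/
def RCe (G : Subgroup (Equiv.Perm ℕ)) (i j : ℕ) : Prop :=
  ∃ g ∈ G, W i = g '' W j

/-- An action of a computable group on the collection of computably enumerable sets is computable
in indices if an index of `g • W e` can be computed from `g` and `e`. -/
def ComputableInIndices {Γ : Type} [Group Γ] (c : ComputableGroup Γ) [MulAction Γ CE] : Prop :=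
  ∃ α : ℕ → ℕ → ℕ, Computable₂ α ∧
    ∀ (g : Γ) (e : ℕ), Wce (α (c.code g) e) = g • Wce e

/-- `R` is a c.e. orbit equivalence relation: the relation on indices induced by the orbit
equivalence relation of an action of a computable group on the collection of computably enumerable
sets that is computable in indices. -/
def IsCeOrbitEquivRel (R : ℕ → ℕ → Prop) : Prop :=
  ∃ (Γ : Type) (_ : Group Γ) (c : ComputableGroup Γ) (_ : MulAction Γ CE),
    ComputableInIndices c ∧ ∀ i j, R i j ↔ ∃ g : Γ, g • Wce i = Wce j

end CeOrbit

/-!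
The reduction sends `e` to an index of `spread (W e)` for one fixed operator `spread` on sets, so it
respects equality of c.e. sets; the point is that `spread A` determines `A` even up to computable
isomorphism.

Cut `ℕ` into consecutive finite blocks, the `c`-th being much longer than all earlier ones together
(`blockStart`, `block`). Call a number *thin* if it is not the value of one of the first `c` partial
recursive functions at an element of an earlier block, `c` being the block it lies in. At most
`c * blockStart c` elements of block `c` fail to be thin, so each block has more thin elements than
there are numbers below it. The non-thin numbers form a c.e. set, and `spread A` consists of them
together with all blocks whose number lies in `A`; its complement consists of the thin elements of
the remaining blocks.

Suppose that a computable permutation `h` maps `spread A` onto `spread B`. Since `h` and its inverse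
are among the first `c` partial recursive functions for all large `c`, thinness forbids either of
them to send an element missing from one of these sets to a later large block. So `h` restricts to
bijections between the parts of the two complements below the `c`-th block, for all large `c`
(`card_missing_eq_of_equiv`). As the thin elements of a block outnumber everything below it, these
cardinalities determine which blocks are present: a downward induction
gives `A = B` (`eq_of_image_spread_eq`).

An action of a computable group on the c.e. sets that is computable in indices reduces to the
previous situation. Each group element acts monotonically, for otherwise the complement of the
halting problem would be r.e. (`W_subset_of_subset`). The same holds for its inverse, so it is an
automorphism of the inclusion order, permutes the singletons, and is therefore induced by a
permutation of `ℕ`, which is computable because indices of the images of singletons are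
(`exists_computable_perm`).
-/

namespace CeOrbit

open Nat.Partrec Nat.Partrec.Code

/-! ### Indices of computably enumerable sets -/

theorem mem_W_iff_evaln {e n : ℕ} :
    n ∈ W e ↔ ∃ k, (evaln k (Denumerable.ofNat Code e) n).isSome := by
  constructor
  · intro h
    obtain ⟨x, hx⟩ := Part.dom_iff_mem.1 h
    obtain ⟨k, hk⟩ := evaln_complete.1 hx
    exact ⟨k, Option.isSome_iff_exists.2 ⟨x, hk⟩⟩
  · rintro ⟨k, hk⟩
    obtain ⟨x, hx⟩ := Option.isSome_iff_exists.1 hk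
    exact Part.dom_iff_mem.2 ⟨x, evaln_sound hx⟩

theorem evaln_isSome_mono {k l : ℕ} (hkl : k ≤ l) {c : Code} {n : ℕ}
    (h : (evaln k c n).isSome) : (evaln l c n).isSome := by
  obtain ⟨x, hx⟩ := Option.isSome_iff_exists.1 h
  exact Option.isSome_iff_exists.2 ⟨x, evaln_mono hkl hx⟩

/-- Projections of the sections of a decidable relation are c.e., uniformly in the parameter. -/
theorem exists_computable_index {P : ℕ → ℕ → ℕ → Bool}
    (hP : Computable fun v : (ℕ × ℕ) × ℕ => P v.1.1 v.1.2 v.2) :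
    ∃ g : ℕ → ℕ, Computable g ∧ ∀ n z, z ∈ W (g n) ↔ ∃ t, P n z t = true := by
  have hF : Partrec fun v : ℕ => Nat.rfind fun t => Part.some (P v.unpair.1 v.unpair.2 t) := by
    refine Partrec.rfind (p := fun v t : ℕ => Part.some (P v.unpair.1 v.unpair.2 t)) ?_
    have h1 : Computable fun u : ℕ × ℕ => (u.1.unpair, u.2) :=
      (Computable.unpair.comp Computable.fst).pair Computable.snd
    exact (hP.comp h1).partrec
  obtain ⟨c, hc⟩ := exists_code.1 (Partrec.nat_iff.1 hF)
  refine ⟨fun n => Encodable.encode (curry c n), ?_, fun n z => ?_⟩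
  · exact Computable.encode.comp
      (primrec₂_curry.to_comp.comp (Computable.const c) Computable.id)
  · change ((Denumerable.ofNat Code _).eval z).Dom ↔ _
    rw [Denumerable.ofNat_encode, eval_curry, hc]
    refine Nat.rfind_dom.trans ?_
    simp

theorem Wce_eq_iff {i j : ℕ} : Wce i = Wce j ↔ W i = W j :=
  Subtype.ext_iff

/-! ### Blocks -/

/-- The least element of the `c`-th block. -/
def blockStart : ℕ → ℕ
  | 0 => 0
  | c + 1 => (c + 2) * blockStart c + 1

theorem primrec_blockStart : Primrec blockStart := by
  have h : Primrec₂ fun c r : ℕ => (c + 2) * r + 1 :=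
    Primrec.succ.comp₂ (Primrec.nat_mul.comp₂
      (Primrec.nat_add.comp₂ Primrec₂.left (Primrec₂.const 2)) Primrec₂.right)
  refine (Primrec.nat_rec₁ 0 h).of_eq fun n => ?_
  induction n with
  | zero => rfl
  | succ n ih => simp only [blockStart, ← ih]

theorem blockStart_strictMono : StrictMono blockStart :=
  strictMono_nat_of_lt_succ fun c => by
    simp only [blockStart]
    nlinarith [Nat.zero_le (c * blockStart c)]

/-- The number of the block in which `z` lies. -/
def block (z : ℕ) : ℕ := Nat.findGreatest (fun c => blockStart c ≤ z) z

theorem le_block_iff {c z : ℕ} : c ≤ block z ↔ blockStart c ≤ z := by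
  constructor
  · intro h
    have h0 : blockStart (block z) ≤ z :=
      Nat.findGreatest_spec (P := fun c => blockStart c ≤ z) (Nat.zero_le z) (Nat.zero_le z)
    exact (blockStart_strictMono.monotone h).trans h0
  · intro h
    exact Nat.le_findGreatest ((blockStart_strictMono.le_apply).trans h) h

theorem block_lt_iff {c z : ℕ} : block z < c ↔ z < blockStart c := by
  rw [← not_le, le_block_iff, not_le]

theorem primrec_block : Primrec block :=
  Primrec.nat_findGreatest Primrec.id
    (Primrec.nat_le.comp₂ (primrec_blockStart.comp₂ Primrec₂.right) Primrec₂.left)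

/-! ### Thin numbers and the operator `spread` -/

/-- The numbers, in any block `c`, that are not the value of one of the first `c` partial recursive
functions at an element of an earlier block. -/
def thin : Set ℕ :=
  {z | ∀ e < block z, ∀ x, block x < block z → z ∉ eval (Denumerable.ofNat Code e) x}

/-- All numbers that are not thin, together with the blocks whose number belongs to `A`. -/
def spread (A : Set ℕ) : Set ℕ := {z | block z ∈ A ∨ z ∉ thin}

theorem exists_computable_spread :
    ∃ f : ℕ → ℕ, Computable f ∧ ∀ i, W (f i) = spread (W i) := by
  -- A witness `t` codes a triple `(k, e, x)`: a bound on computation time and the pair refuting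
  -- thinness.
  let D : ℕ → ℕ × ℕ × ℕ := Denumerable.ofNat (ℕ × ℕ × ℕ)
  let P : ℕ → ℕ → ℕ → Bool := fun i z t =>
    (evaln (D t).1 (Denumerable.ofNat Code i) (block z)).isSome ||
      (decide ((D t).2.1 < block z) && (decide (block (D t).2.2 < block z) &&
        decide (evaln (D t).1 (Denumerable.ofNat Code (D t).2.1) (D t).2.2 = some z)))
  have hP : Primrec fun v : (ℕ × ℕ) × ℕ => P v.1.1 v.1.2 v.2 := by
    have hi : Primrec fun v : (ℕ × ℕ) × ℕ => v.1.1 := Primrec.fst.comp Primrec.fst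
    have hz : Primrec fun v : (ℕ × ℕ) × ℕ => v.1.2 := Primrec.snd.comp Primrec.fst
    have hD : Primrec fun v : (ℕ × ℕ) × ℕ => D v.2 :=
      (Primrec.ofNat (ℕ × ℕ × ℕ)).comp Primrec.snd
    have hk := Primrec.fst.comp hD
    have he := Primrec.fst.comp (Primrec.snd.comp hD)
    have hx := Primrec.snd.comp (Primrec.snd.comp hD)
    have hbz := primrec_block.comp hz
    refine Primrec.or.comp
      (Primrec.option_isSome.comp
        (primrec_evaln.comp ((hk.pair ((Primrec.ofNat Code).comp hi)).pair hbz)))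
      (Primrec.and.comp (Primrec.nat_lt.comp he hbz).decide
        (Primrec.and.comp (Primrec.nat_lt.comp (primrec_block.comp hx) hbz).decide
          (Primrec.eq.comp
            (primrec_evaln.comp ((hk.pair ((Primrec.ofNat Code).comp he)).pair hx))
            (Primrec.option_some.comp hz)).decide))
  obtain ⟨f, hf, hW⟩ := exists_computable_index hP.to_comp
  refine ⟨f, hf, fun i => Set.ext fun z => ?_⟩
  rw [hW]
  have hD : ∀ a : ℕ × ℕ × ℕ, D (Encodable.encode a) = a := Denumerable.ofNat_encode
  simp only [P, Bool.or_eq_true, Bool.and_eq_true, decide_eq_true_eq]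
  constructor
  · rintro ⟨t, h | ⟨he, hx, h⟩⟩
    · exact Or.inl (mem_W_iff_evaln.2 ⟨_, h⟩)
    · exact Or.inr fun hz => hz _ he _ hx (evaln_sound h)
  · rintro (h | h)
    · obtain ⟨k, hk⟩ := mem_W_iff_evaln.1 h
      exact ⟨Encodable.encode (k, 0, 0), Or.inl (by rw [hD]; exact hk)⟩
    · simp only [thin, Set.mem_ofPred_eq, not_forall, not_not] at h
      obtain ⟨e, he, x, hx, h⟩ := h
      obtain ⟨k, hk⟩ := evaln_complete.1 h
      exact ⟨Encodable.encode (k, e, x), Or.inr (by rw [hD]; exact ⟨he, hx, hk⟩)⟩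

/-- Every computable function eventually maps only elements of the same or later blocks to thin
elements. -/
theorem exists_block_le_of_thin {f : ℕ → ℕ} (hf : Computable f) :
    ∃ e, ∀ x, f x ∈ thin → e < block (f x) → block (f x) ≤ block x := by
  obtain ⟨c, hc⟩ := exists_code.1 (Partrec.nat_iff.1 hf.partrec)
  refine ⟨Encodable.encode c, fun x hx he => ?_⟩
  by_contra! hlt
  refine hx _ he x hlt ?_
  rw [Denumerable.ofNat_encode, hc]
  exact Part.mem_some _

/-! ### Counting the complement of `spread A` -/

open Classical in
/-- The numbers below block `c` that are missing from `spread A`. -/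
noncomputable def missing (A : Set ℕ) (c : ℕ) : Finset ℕ :=
  {z ∈ Finset.range (blockStart c) | z ∉ spread A}

open Classical in
/-- The thin elements of block `c`. -/
noncomputable def thinBlock (c : ℕ) : Finset ℕ :=
  {z ∈ Finset.Ico (blockStart c) (blockStart (c + 1)) | z ∈ thin}

theorem mem_missing {A : Set ℕ} {c z : ℕ} : z ∈ missing A c ↔ block z < c ∧ z ∉ spread A := by
  simp [missing, block_lt_iff]

theorem mem_thinBlock {c z : ℕ} : z ∈ thinBlock c ↔ block z = c ∧ z ∈ thin := by
  classical
  rw [thinBlock, Finset.mem_filter, Finset.mem_Ico, ← le_block_iff, ← block_lt_iff]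
  have : (c ≤ block z ∧ block z < c + 1) ↔ block z = c := by omega
  rw [this]

theorem card_missing_le (A : Set ℕ) (c : ℕ) : (missing A c).card ≤ blockStart c := by
  classical
  exact (Finset.card_filter_le _ _).trans (Finset.card_range _).le

/-- The non-thin elements of block `c` are values at the `c * blockStart c` pairs `(e, x)`, while
the block has `(c + 1) * blockStart c + 1` elements. -/
theorem blockStart_lt_card_thinBlock (c : ℕ) : blockStart c < (thinBlock c).card := by
  classical
  let val : ℕ × ℕ → ℕ := fun p =>
    if h : (eval (Denumerable.ofNat Code p.1) p.2).Dom then (eval _ p.2).get h else 0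
  let V := (Finset.range c ×ˢ Finset.range (blockStart c)).image val
  have hV : V.card ≤ c * blockStart c := by
    refine Finset.card_image_le.trans ?_
    simp
  have hsub : Finset.Ico (blockStart c) (blockStart (c + 1)) ⊆ thinBlock c ∪ V := by
    intro z hz
    rw [Finset.mem_union]
    by_cases ht : z ∈ thin
    · exact Or.inl (Finset.mem_filter.2 ⟨hz, ht⟩)
    · right
      rw [Finset.mem_Ico, ← le_block_iff, ← block_lt_iff] at hz
      have hc : block z = c := by omega
      simp only [thin, Set.mem_ofPred_eq, not_forall, not_not] at ht
      obtain ⟨e, he, x, hx, h⟩ := ht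
      rw [hc] at he hx
      refine Finset.mem_image.2 ⟨(e, x), ?_, ?_⟩
      · simpa using ⟨he, block_lt_iff.1 hx⟩
      · obtain ⟨hd, hz⟩ := h
        simp only [val, dif_pos hd, hz]
  have h1 := Finset.card_le_card hsub
  have h2 := Finset.card_union_le (thinBlock c) V
  rw [Nat.card_Ico] at h1
  have h3 : blockStart (c + 1) = c * blockStart c + 2 * blockStart c + 1 := by
    simp only [blockStart]; ring
  omega

theorem card_missing_succ_of_mem {A : Set ℕ} {c : ℕ} (hc : c ∈ A) :
    (missing A (c + 1)).card = (missing A c).card := by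
  congr 1
  ext z
  simp only [mem_missing]
  refine ⟨fun ⟨h1, h2⟩ => ⟨lt_of_le_of_ne (Nat.lt_succ_iff.1 h1) ?_, h2⟩,
    fun ⟨h1, h2⟩ => ⟨h1.trans c.lt_succ_self, h2⟩⟩
  rintro rfl
  exact h2 (Or.inl hc)

theorem card_missing_succ_of_notMem {A : Set ℕ} {c : ℕ} (hc : c ∉ A) :
    (missing A (c + 1)).card = (missing A c).card + (thinBlock c).card := by
  classical
  rw [← Finset.card_union_of_disjoint]
  · congr 1
    ext z
    simp only [Finset.mem_union, mem_missing, mem_thinBlock]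
    constructor
    · rintro ⟨h1, h2⟩
      rcases Nat.lt_succ_iff_lt_or_eq.1 h1 with h | h
      · exact Or.inl ⟨h, h2⟩
      · exact Or.inr ⟨h, by_contra fun h' => h2 (Or.inr h')⟩
    · rintro (⟨h1, h2⟩ | ⟨rfl, h2⟩)
      · exact ⟨h1.trans c.lt_succ_self, h2⟩
      · exact ⟨Nat.lt_succ_self _, fun h => h.elim hc fun h' => h' h2⟩
  · rw [Finset.disjoint_left]
    intro z h1 h2
    exact (mem_missing.1 h1).1.ne (mem_thinBlock.1 h2).1

/-- The number of missing elements below block `c + 1` tells whether `c ∈ A`, because block `c`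
alone would contribute more than can be missing below it. -/
theorem mem_iff_and_card_missing_eq {A B : Set ℕ} {c : ℕ}
    (h : (missing A (c + 1)).card = (missing B (c + 1)).card) :
    (c ∈ A ↔ c ∈ B) ∧ (missing A c).card = (missing B c).card := by
  have hA := card_missing_le A c
  have hB := card_missing_le B c
  have hc := blockStart_lt_card_thinBlock c
  by_cases h1 : c ∈ A <;> by_cases h2 : c ∈ B <;>
    simp only [h1, h2, card_missing_succ_of_mem, card_missing_succ_of_notMem,
      not_false_eq_true, iff_true, true_and, iff_self, iff_false, not_true_eq_false] at h ⊢ <;>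
    omega

theorem card_missing_eq_of_equiv {A B : Set ℕ} {h : ℕ ≃ ℕ} (hh : h.Computable)
    (hAB : ∀ x, x ∈ spread A ↔ h x ∈ spread B) :
    ∃ c₀, ∀ c, c₀ ≤ c → (missing A c).card = (missing B c).card := by
  obtain ⟨e₁, h₁⟩ := exists_block_le_of_thin hh.1
  obtain ⟨e₂, h₂⟩ := exists_block_le_of_thin hh.2
  have hthin : ∀ {C : Set ℕ} {z : ℕ}, z ∉ spread C → z ∈ thin := fun hz =>
    by_contra fun h' => hz (Or.inr h')
  refine ⟨max e₁ e₂ + 1, fun c hc => Finset.card_equiv h fun x => ?_⟩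
  rw [mem_missing, mem_missing, ← hAB]
  refine and_congr_left fun hx => ?_
  have t₁ := h₁ x (hthin ((hAB x).not.1 hx))
  have t₂ := h₂ (h x)
  rw [Equiv.symm_apply_apply] at t₂
  have t₃ := t₂ (hthin hx)
  omega

theorem eq_of_image_spread_eq {A B : Set ℕ} {h : ℕ ≃ ℕ} (hh : h.Computable)
    (hAB : h '' spread A = spread B) : A = B := by
  obtain ⟨c₀, hc₀⟩ := card_missing_eq_of_equiv (A := A) (B := B) hh fun x => by
    rw [← hAB, h.injective.mem_set_image]
  have hdown : ∀ k c, c₀ ≤ c + k → (missing A c).card = (missing B c).card := by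
    intro k
    induction k with
    | zero => exact fun c hc => hc₀ c hc
    | succ k ih => exact fun c hc => (mem_iff_and_card_missing_eq (ih (c + 1) (by omega))).2
  ext c
  exact (mem_iff_and_card_missing_eq (hdown c₀ (c + 1) (by omega))).1

/-! ### Actions computable in indices -/

/-- An index-computable map on c.e. sets is monotone: if `z` were in the image of `A` but not in
that of `B ⊇ A`, then enumerating `A`, and `B` as soon as a given program halts, would make
non-halting r.e. -/
theorem W_subset_of_subset {T : ℕ → ℕ} (hT : Computable T)
    (hext : ∀ i j, W i = W j → W (T i) = W (T j)) {i j : ℕ} (hij : W i ⊆ W j) :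
    W (T i) ⊆ W (T j) := by
  intro z hzi
  by_contra hzj
  let P : ℕ → ℕ → ℕ → Bool := fun n y t =>
    (evaln t (Denumerable.ofNat Code i) y).isSome ||
      ((evaln t (Denumerable.ofNat Code j) y).isSome &&
        (evaln t (Denumerable.ofNat Code n) 0).isSome)
  have hP : Primrec fun v : (ℕ × ℕ) × ℕ => P v.1.1 v.1.2 v.2 := by
    have hn : Primrec fun v : (ℕ × ℕ) × ℕ => v.1.1 := Primrec.fst.comp Primrec.fst
    have hy : Primrec fun v : (ℕ × ℕ) × ℕ => v.1.2 := Primrec.snd.comp Primrec.fst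
    have ht : Primrec fun v : (ℕ × ℕ) × ℕ => v.2 := Primrec.snd
    have hev := fun (e : ℕ) => Primrec.option_isSome.comp
      (primrec_evaln.comp ((ht.pair (Primrec.const (Denumerable.ofNat Code e))).pair hy))
    exact Primrec.or.comp (hev i) (Primrec.and.comp (hev j) (Primrec.option_isSome.comp
      (primrec_evaln.comp ((ht.pair ((Primrec.ofNat Code).comp hn)).pair (Primrec.const 0)))))
  obtain ⟨g, hg, hW⟩ := exists_computable_index hP.to_comp
  have hmem : ∀ n y, y ∈ W (g n) ↔ y ∈ W i ∨ y ∈ W j ∧ 0 ∈ W n := by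
    intro n y
    rw [hW]
    simp only [P, Bool.or_eq_true, Bool.and_eq_true, mem_W_iff_evaln]
    constructor
    · rintro ⟨t, h | ⟨h, h'⟩⟩
      · exact Or.inl ⟨t, h⟩
      · exact Or.inr ⟨⟨t, h⟩, ⟨t, h'⟩⟩
    · rintro (⟨t, h⟩ | ⟨⟨t, h⟩, ⟨s, h'⟩⟩)
      · exact ⟨t, Or.inl h⟩
      · exact ⟨max t s, Or.inr ⟨evaln_isSome_mono (le_max_left _ _) h,
          evaln_isSome_mono (le_max_right _ _) h'⟩⟩
  refine ComputablePred.halting_problem_not_re 0 (REPred.of_eq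
    (p := fun c : Code => z ∈ W (T (g (Encodable.encode c)))) ?_ fun c => ?_)
  · exact Partrec.dom_re (eval_part.comp
      ((Computable.ofNat Code).comp (hT.comp (hg.comp Computable.encode)))
      (Computable.const z))
  · have hc : 0 ∈ W (Encodable.encode c) ↔ (eval c 0).Dom := by
      change ((Denumerable.ofNat Code _).eval 0).Dom ↔ _
      rw [Denumerable.ofNat_encode]
    by_cases h : (eval c 0).Dom
    · have : W (g (Encodable.encode c)) = W j := by
        ext y
        rw [hmem, hc]
        exact ⟨fun h' => h'.elim (fun h => hij h) And.left, fun h' => Or.inr ⟨h', h⟩⟩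
      rw [hext _ _ this]
      exact iff_of_false hzj (not_not.2 h)
    · have : W (g (Encodable.encode c)) = W i := by
        ext y
        rw [hmem, hc]
        exact ⟨fun h' => h'.elim id fun h'' => absurd h''.2 h, Or.inl⟩
      rw [hext _ _ this]
      exact iff_of_true hzi h

theorem exists_computable_singleton_index :
    ∃ s : ℕ → ℕ, Computable s ∧ ∀ n, W (s n) = {n} := by
  obtain ⟨s, hs, hW⟩ := exists_computable_index (P := fun n z _ => decide (z = n))
    (Primrec.eq.comp (Primrec.snd.comp Primrec.fst)
      (Primrec.fst.comp Primrec.fst)).decide.to_comp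
  exact ⟨s, hs, fun n => Set.ext fun z => by simp [hW]⟩

/-- A function picking elements from uniformly c.e. singletons is computable. -/
theorem computable_of_W_eq_singleton {t p : ℕ → ℕ} (ht : Computable t)
    (hp : ∀ n, W (t n) = {p n}) : Computable p := by
  -- The search runs through the pairs `m = (k, y)`, looking for `y` enumerated within `k` steps.
  let u : ℕ → ℕ → Option ℕ := fun n m =>
    bif (evaln m.unpair.1 (Denumerable.ofNat Code (t n)) m.unpair.2).isSome
      then some m.unpair.2 else none
  have hu : Computable₂ u := by
    have hm : Computable fun v : ℕ × ℕ => v.2.unpair := Computable.unpair.comp Computable.snd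
    exact Computable.cond (Primrec.option_isSome.to_comp.comp (primrec_evaln.to_comp.comp
      (((Computable.fst.comp hm).pair
        ((Computable.ofNat Code).comp (ht.comp Computable.fst))).pair
          (Computable.snd.comp hm))))
      (Computable.option_some.comp (Computable.snd.comp hm)) (Computable.const none)
  have key : ∀ n m a, a ∈ u n m → a = p n := by
    intro n m a ha
    cases h : (evaln m.unpair.1 (Denumerable.ofNat Code (t n)) m.unpair.2).isSome with
    | false => simp [u, h] at ha
    | true =>
      have h1 : m.unpair.2 ∈ W (t n) := mem_W_iff_evaln.2 ⟨_, h⟩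
      rw [hp] at h1
      simp only [u, h, cond_true, Option.mem_def, Option.some.injEq] at ha
      exact ha.symm.trans h1
  refine (Partrec.rfindOpt hu).of_eq fun n => ?_
  have hdom : (Nat.rfindOpt (u n)).Dom := by
    rw [Nat.rfindOpt_dom]
    have h1 : p n ∈ W (t n) := by rw [hp]; rfl
    obtain ⟨k, hk⟩ := mem_W_iff_evaln.1 h1
    exact ⟨Nat.pair k (p n), p n, by simp [u, hk]⟩
  obtain ⟨a, ha⟩ := Part.dom_iff_mem.1 hdom
  obtain ⟨m, hm⟩ := Nat.rfindOpt_spec ha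
  rw [Part.eq_some_iff.2 ha, key n m a hm]
  rfl

theorem exists_index (A : CE) : ∃ e, Wce e = A := by
  obtain ⟨A, hA⟩ := A
  have hF : Partrec fun n : ℕ => (Part.assert (n ∈ A) fun _ => Part.some ()).map fun _ => 0 :=
    hA.map (Computable.const 0).to₂
  obtain ⟨c, hc⟩ := exists_code.1 (Partrec.nat_iff.1 hF)
  refine ⟨Encodable.encode c, Subtype.ext (Set.ext fun n => ?_)⟩
  change ((Denumerable.ofNat Code _).eval n).Dom ↔ _
  rw [Denumerable.ofNat_encode, hc]
  simp [Part.assert]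

section Action

variable {Γ : Type} [Group Γ] {c : ComputableGroup Γ} [MulAction Γ CE]

theorem smul_subset_smul (hc : ComputableInIndices c) (g : Γ) {A B : CE} (hAB : A.1 ⊆ B.1) :
    (g • A).1 ⊆ (g • B).1 := by
  obtain ⟨α, hα, h⟩ := hc
  obtain ⟨i, rfl⟩ := exists_index A
  obtain ⟨j, rfl⟩ := exists_index B
  rw [← h, ← h]
  refine W_subset_of_subset (T := α (c.code g)) (hα.comp (Computable.const _) Computable.id)
    (fun i j hij => ?_) hAB
  rw [← Wce_eq_iff] at hij ⊢
  rw [h, h, hij]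

theorem smul_subset_smul_iff (hc : ComputableInIndices c) (g : Γ) {A B : CE} :
    (g • A).1 ⊆ (g • B).1 ↔ A.1 ⊆ B.1 := by
  refine ⟨fun h => ?_, smul_subset_smul hc g⟩
  simpa using smul_subset_smul hc g⁻¹ h

/-- An order automorphism fixes the least element and sends atoms to atoms, so singletons go to
singletons. -/
theorem exists_smul_eq_singleton (hc : ComputableInIndices c) (g : Γ) {A : CE} {n : ℕ}
    (hA : A.1 = {n}) : ∃ m, (g • A).1 = {m} := by
  obtain ⟨s, -, hs⟩ := exists_computable_singleton_index
  have hne : (g • A).1.Nonempty := by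
    by_contra hempty
    rw [Set.not_nonempty_iff_eq_empty] at hempty
    -- Every c.e. set contains `g • A = ∅`, so every c.e. set contains `A`.
    have hsub : ∀ B : CE, A.1 ⊆ B.1 := fun B => by
      rw [← smul_subset_smul_iff hc g, hempty]
      exact Set.empty_subset _
    have h1 := hsub (Wce (s (n + 1)))
    change A.1 ⊆ W (s (n + 1)) at h1
    rw [hA, hs, Set.singleton_subset_iff] at h1
    exact absurd h1 (by simp)
  obtain ⟨m, hm⟩ := hne
  refine ⟨m, ?_⟩
  have hsm : (Wce (s m)).1 = {m} := hs m
  have h1 : (g⁻¹ • Wce (s m)).1 ⊆ A.1 := by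
    rw [← smul_subset_smul_iff hc g, smul_inv_smul, hsm]
    exact Set.singleton_subset_iff.2 hm
  rw [hA, Set.subset_singleton_iff_eq] at h1
  rcases h1 with h1 | h1
  · -- The set `g⁻¹ • {m}` is not empty: otherwise it would lie in `g⁻¹ • {m + 1}`.
    have h2 : (g⁻¹ • Wce (s m)).1 ⊆ (g⁻¹ • Wce (s (m + 1))).1 := by
      rw [h1]
      exact Set.empty_subset _
    rw [smul_subset_smul_iff hc, hsm] at h2
    change {m} ⊆ W (s (m + 1)) at h2
    rw [hs, Set.singleton_subset_iff] at h2
    exact absurd h2 (by simp)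
  · have h2 : g⁻¹ • Wce (s m) = A := Subtype.ext (h1.trans hA.symm)
    rw [← h2, smul_inv_smul, hsm]

theorem exists_computable_perm (hc : ComputableInIndices c) (g : Γ) :
    ∃ h : ℕ ≃ ℕ, h.Computable ∧ ∀ A : CE, h '' A.1 = (g • A).1 := by
  obtain ⟨s, hs, hsing⟩ := exists_computable_singleton_index
  have hsing' : ∀ n, (Wce (s n)).1 = {n} := hsing
  choose p hp using fun (g : Γ) (n : ℕ) => exists_smul_eq_singleton hc g (hsing' n)
  have hinv : ∀ g n, p g⁻¹ (p g n) = n := by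
    intro g n
    have h1 : Wce (s (p g n)) = g • Wce (s n) := Subtype.ext ((hsing' _).trans (hp g n).symm)
    have h2 := hp g⁻¹ (p g n)
    rw [h1, inv_smul_smul, hsing'] at h2
    exact (Set.singleton_injective h2).symm
  have hcomp : ∀ g, Computable (p g) := by
    obtain ⟨α, hα, h⟩ := hc
    intro g
    refine computable_of_W_eq_singleton (t := fun n => α (c.code g) (s n))
      (hα.comp (Computable.const _) hs) fun n => ?_
    rw [← hp g n, ← h]
    rfl
  have hmem : ∀ (A : CE) n, p g n ∈ (g • A).1 ↔ n ∈ A.1 := by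
    intro A n
    rw [← Set.singleton_subset_iff, ← hp g n, smul_subset_smul_iff hc, hsing',
      Set.singleton_subset_iff]
  let h : ℕ ≃ ℕ := ⟨p g, p g⁻¹, hinv g, fun n => by simpa using hinv g⁻¹ n⟩
  refine ⟨h, ⟨hcomp g, hcomp g⁻¹⟩, fun A => Set.ext fun z => ?_⟩
  obtain ⟨n, rfl⟩ := h.surjective z
  rw [h.injective.mem_set_image]
  exact (hmem A n).symm

end Action

theorem isCeOrbitEquivRel_eqCe : IsCeOrbitEquivRel EqCe := by
  let triv : MulAction Unit CE :=
    { smul := fun _ A => A, one_smul := fun _ => rfl, mul_smul := fun _ _ _ => rfl }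
  refine ⟨Unit, inferInstance,
    { code := fun _ => 0
      code_injective := fun _ _ _ => rfl
      range_computable := ?_
      mul_computable := ⟨fun _ _ => 0, Computable.const 0, fun _ _ => rfl⟩ }, triv,
    ⟨fun _ e => e, Computable.snd, fun _ _ => rfl⟩, fun i j => ?_⟩
  · refine ComputablePred.of_eq (p := fun n : ℕ => n = 0)
      (Primrec.eq.comp Primrec.id (Primrec.const 0)).computablePred fun n => ?_
    simp
  · exact ⟨fun h => ⟨(), Wce_eq_iff.2 h⟩, fun ⟨_, h⟩ => Wce_eq_iff.1 h⟩

theorem IsComputablePermGroup.computable_of_mem {G : Subgroup (Equiv.Perm ℕ)}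
    (hG : IsComputablePermGroup G) {g : Equiv.Perm ℕ} (hg : g ∈ G) : Equiv.Computable g := by
  obtain ⟨Γ, _, c, ρ, ⟨a, ha, haρ⟩, rfl⟩ := hG
  obtain ⟨γ, rfl⟩ := hg
  have hcomp : ∀ γ : Γ, Computable (ρ γ) := fun γ =>
    (ha.comp (Computable.const (c.code γ)) Computable.id).of_eq fun n => haρ γ n
  refine ⟨hcomp γ, ?_⟩
  have h := hcomp γ⁻¹
  rwa [map_inv] at h

end CeOrbit

open CeOrbit in
theorem mainTheorem4 :
    (∃ f : ℕ → ℕ,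
      CeOrbit.IsReduction f CeOrbit.EqCe CeOrbit.EqCe ∧
      (∀ i j : ℕ, CeOrbit.W i ≠ CeOrbit.W j →
        ¬ CeOrbit.CompIso (CeOrbit.W (f i)) (CeOrbit.W (f j))) ∧
      (∀ G : Subgroup (Equiv.Perm ℕ), CeOrbit.IsComputablePermGroup G →
        CeOrbit.IsReduction f CeOrbit.EqCe (CeOrbit.RCe G))) ∧
    CeOrbit.IsCeOrbitEquivRel CeOrbit.EqCe ∧
    (∀ R : ℕ → ℕ → Prop, CeOrbit.IsCeOrbitEquivRel R →
      CeOrbit.Reducible CeOrbit.EqCe R) := by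
  obtain ⟨f, hf, hW⟩ := exists_computable_spread
  have hext : ∀ i j, W i = W j → W (f i) = W (f j) := fun i j h => by rw [hW, hW, h]
  have hiso : ∀ i j, ∀ h : ℕ ≃ ℕ, h.Computable → h '' W (f i) = W (f j) → W i = W j := by
    intro i j h hh hij
    rw [hW, hW] at hij
    exact eq_of_image_spread_eq hh hij
  have hid : (Equiv.refl ℕ).Computable := ⟨Computable.id, Computable.id⟩
  refine ⟨⟨f, ⟨hf, fun i j => ⟨hext i j, fun h => hiso i j _ hid ((Set.image_id _).trans h)⟩⟩,
    fun i j hij ⟨h, hh, himg⟩ => hij (hiso i j h hh himg),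
    fun G hG => ⟨hf, fun i j => ⟨fun h => ⟨1, G.one_mem, ?_⟩, ?_⟩⟩⟩,
    isCeOrbitEquivRel_eqCe, ?_⟩
  · simpa using hext i j h
  · rintro ⟨g, hg, h⟩
    exact (hiso j i g (hG.computable_of_mem hg) h.symm).symm
  · rintro R ⟨Γ, _, c, _, hc, hR⟩
    refine ⟨f, hf, fun i j => ?_⟩
    rw [hR]
    refine ⟨fun h => ⟨1, by rw [one_smul]; exact Wce_eq_iff.2 (hext i j h)⟩, ?_⟩
    rintro ⟨g, hg⟩
    obtain ⟨h, hh, himg⟩ := exists_computable_perm hc g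
    refine hiso i j h hh ?_
    have := himg (Wce (f i))
    rw [hg] at this
    exact this
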